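/- Composition is written from left to right. A \emph{category with subobjects} is a category with a class of \emph{inclusions}, which are monomorphisms and form a strict preorder on the set of all objects, such that if $hg$ and $g$ are inclusions then so is $h$. A \emph{normal cone} $\gamma$ with apex $c_\gamma$ assigns to each object $c$ a morphism $\gamma(c)\colon c\to c_\gamma$ such that $j\gamma(b)=\gamma(a)$ for every inclusion $j\colon a\to b$, and $\gamma(m)$ is an isomorphism for some $m$. The category is \emph{normal} if inclusions split, every morphism is of the form $f=quj$ with $q$ a retraction (a right inverse of an inclusion), $u$ an isomorphism and $j$ an inclusion, and each object $c$ is the apex of a normal cone $\gamma$ with $\gamma(c)=1_c$. Put $f^\circ=qu$. For a morphism $f$ with domain $c_\gamma$, let $\gamma * f^\circ$ be the normal cone $c\mapsto\gamma(c)f^\circ$. Normal cones are multiplied by $\gamma\cdot\delta=\gamma*(\delta(c_\gamma))^\circ$. The functor $H(\gamma;-)$ is given by $H(\gamma;c)=\{\gamma*f^\circ : f\in C(c_\gamma,c)\}$, $H(\gamma;g)\colon\gamma*f^\circ\mapsto\gamma*(fg)^\circ$. The \emph{normal dual} $N^*C$ of a normal category $C$ is the full subcategory of the category of set-valued functors on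 $C$ with objects $H(\varepsilon;-)$, $\varepsilon$ an idempotent normal cone; its inclusions are the inclusions of subfunctors. An \emph{isomorphism} of normal categories is a functor with a two-sided inverse functor (on the nose), both preserving inclusions. For a regular semigroup $S$ with set of idempotents $E(S)$, the normal category $\mathbb L(S)$ has objects $Se$ $(e\in E(S))$ and morphisms $\rho(e,u,f)\colon Se\to Sf$, $x\mapsto xu$ $(u\in eSf)$; the normal category $\mathbb R(S)$ has objects $eS$ and morphisms $\kappa(e,u,f)\colon eS\to fS$, $x\mapsto ux$ $(u\in fSe)$; inclusions are set inclusions. For $e\in E(S)$ let $\rho^e$ be the normal cone in $\mathbb L(S)$ with apex $Se$ whose components are $x\mapsto xe$, and let $\lambda^e$ be the normal cone in $\mathbb R(S)$ with apex $eS$ whose components are $x\mapsto ex$. The cross-connection functors $\Gamma\colon\mathbb R(S)\to N^*\mathbb L(S)$ and $\Delta\colon\mathbb L(S)\to N^*\mathbb R(S)$ are given by $\Gamma(eS)=H(\rho^e;-)$, $\Gamma(\kappa(e,u,f))\colon\rho^e*g^\circ\mapsto\rho^f*(\rho(f,u,e)\,g)^\circ$, and $\Delta(Se)=H(\lambda^e;-)$,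 $\Delta(\rho(e,u,f))\colon\lambda^e*g^\circ\mapsto\lambda^f*(\kappa(f,u,e)\,g)^\circ$. \textbf{Theorem.} Let $S$ be a semilattice (a commutative semigroup of idempotents). Then: (1) $N^*\mathbb L(S)$ is a normal category, and it is isomorphic, as a normal category, to $\mathbb R(S)$; (2) $N^*\mathbb R(S)$ is a normal category, and it is isomorphic, as a normal category, to $\mathbb L(S)$; (3) the cross-connection functors $\Gamma$ and $\Delta$ are isomorphisms of normal categories. -/

import Mathlib

open CategoryTheory

universe v u

namespace CrossConnection

/-! ## Categories with subobjects, normal categories -/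

/-- A category with subobjects: a category with a distinguished class of morphisms, the
inclusions.  They form a strict preorder on the set of all objects, they are monomorphisms, and
`f = h ≫ g` with `f`, `g` inclusions forces `h` to be an inclusion. -/
class SubobjectCategory (C : Type u) [Category.{v} C] where
  /-- The morphism is an inclusion. -/
  Incl : ∀ {a b : C}, (a ⟶ b) → Prop
  incl_id : ∀ a : C, Incl (𝟙 a)
  incl_comp : ∀ {a b c : C} (f : a ⟶ b) (g : b ⟶ c), Incl f → Incl g → Incl (f ≫ g)
  incl_unique : ∀ {a b : C} (f g : a ⟶ b), Incl f → Incl g → f = g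
  incl_antisymm : ∀ {a b : C} (f : a ⟶ b) (g : b ⟶ a), Incl f → Incl g → a = b
  incl_mono : ∀ {a b : C} (f : a ⟶ b), Incl f → Mono f
  incl_of_comp : ∀ {a b c : C} (h : a ⟶ b) (g : b ⟶ c), Incl (h ≫ g) → Incl g → Incl h

section Normal

variable (C : Type u) [Category.{v} C] [SubobjectCategory C]

/-- A normal cone: a family of morphisms `app c : c ⟶ apex`, one for each object, compatible with
inclusions and with at least one component an isomorphism. -/
structure NormalCone where
  apex : C
  app : ∀ c : C, c ⟶ apex
  incl_app : ∀ {a b : C} (j : a ⟶ b), SubobjectCategory.Incl j → j ≫ app b = app a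
  exists_isIso : ∃ m : C, IsIso (app m)

variable {C}

theorem NormalCone.ext_of_incl {γ δ : NormalCone C} (i : γ.apex ⟶ δ.apex) (k : δ.apex ⟶ γ.apex)
    (hi : SubobjectCategory.Incl i) (hk : SubobjectCategory.Incl k)
    (h : ∀ c, γ.app c ≫ i = δ.app c) : γ = δ := by
  obtain ⟨x, f, _, _⟩ := γ
  obtain ⟨y, g, _, _⟩ := δ
  obtain rfl : x = y := SubobjectCategory.incl_antisymm i k hi hk
  obtain rfl : i = 𝟙 x := SubobjectCategory.incl_unique _ _ hi (SubobjectCategory.incl_id _)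
  obtain rfl : f = g := by
    funext c
    simpa using h c
  rfl

/-- A retraction is a right inverse of an inclusion. -/
def IsRetraction {a b : C} (q : a ⟶ b) : Prop :=
  ∃ j : b ⟶ a, SubobjectCategory.Incl j ∧ j ≫ q = 𝟙 b

/-- A normal factorization `f = q ≫ u ≫ j`: `q` a retraction, `u` an isomorphism, `j` an
inclusion. -/
structure NormalFactorization {a b : C} (f : a ⟶ b) where
  coim : C
  im : C
  q : a ⟶ coim
  u : coim ⟶ im
  j : im ⟶ b
  isRetraction_q : IsRetraction q
  isIso_u : IsIso u
  incl_j : SubobjectCategory.Incl j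
  fac : q ≫ u ≫ j = f

variable (C)

/-- A normal category: inclusions split, morphisms have normal factorizations, and every
object `c` is the apex of a normal cone whose component at `c` is the identity. -/
class NormalCategory : Prop where
  incl_splits : ∀ {a b : C} (j : a ⟶ b), SubobjectCategory.Incl j → ∃ q : b ⟶ a, j ≫ q = 𝟙 a
  exists_factorization : ∀ {a b : C} (f : a ⟶ b), Nonempty (NormalFactorization f)
  exists_cone : ∀ c : C, ∃ (γ : NormalCone C) (h : γ.apex = c), γ.app c ≫ eqToHom h = 𝟙 c

end Normal

/-- An isomorphism of normal categories: a functor with a strict two-sided inverse functor, both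
preserving inclusions. -/
structure IsNormalIso {C : Type*} [Category C] [SubobjectCategory C]
    {D : Type*} [Category D] [SubobjectCategory D] (F : C ⥤ D) : Prop where
  exists_inverse : ∃ G : D ⥤ C, F ⋙ G = 𝟭 C ∧ G ⋙ F = 𝟭 D ∧
    (∀ {a b : C} (f : a ⟶ b), SubobjectCategory.Incl f → SubobjectCategory.Incl (F.map f)) ∧
    (∀ {a b : D} (f : a ⟶ b), SubobjectCategory.Incl f → SubobjectCategory.Incl (G.map f))

/-- Two normal categories are isomorphic. -/
def NormalIsomorphic (C : Type*) [Category C] [SubobjectCategory C]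
    (D : Type*) [Category D] [SubobjectCategory D] : Prop :=
  ∃ F : C ⥤ D, IsNormalIso F

/-! ## The semigroup of normal cones and the normal dual -/

section Dual

variable {C : Type u} [Category.{v} C] [SubobjectCategory C] [NormalCategory C]

/-- A normal factorization of `f`.  It is not unique, but the image `im` and the epimorphic
component `q ≫ u` do not depend on its choice. -/
noncomputable def fact {a b : C} (f : a ⟶ b) : NormalFactorization f :=
  (NormalCategory.exists_factorization f).some

/-- The image of `f`. -/
noncomputable abbrev im {a b : C} (f : a ⟶ b) : C := (fact f).im

/-- The epimorphic component `f°` of `f`. -/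
noncomputable def epiPart {a b : C} (f : a ⟶ b) : a ⟶ im f := (fact f).q ≫ (fact f).u

/-- The inclusion of the image of `f`. -/
noncomputable def imIncl {a b : C} (f : a ⟶ b) : im f ⟶ b := (fact f).j

theorem incl_imIncl {a b : C} (f : a ⟶ b) : SubobjectCategory.Incl (imIncl f) := (fact f).incl_j

theorem epiPart_imIncl {a b : C} (f : a ⟶ b) : epiPart f ≫ imIncl f = f := by
  have := (fact f).fac
  rw [epiPart, imIncl, Category.assoc]
  exact this

theorem exists_incl_isIso {a b : C} (f : a ⟶ b) :
    ∃ (c : C) (j : c ⟶ a), SubobjectCategory.Incl j ∧ IsIso (j ≫ epiPart f) := by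
  obtain ⟨j, hj, h⟩ := (fact f).isRetraction_q
  refine ⟨_, j, hj, ?_⟩
  have e : j ≫ epiPart f = (fact f).u := by
    rw [epiPart, ← Category.assoc, h, Category.id_comp]
  rw [e]
  exact (fact f).isIso_u

namespace NormalCone

/-- Every subobject of the apex is, up to isomorphism, the restriction of the cone to a
subobject of a vertex where the cone is an isomorphism. -/
theorem exists_isIso_comp (γ : NormalCone C) {c : C} (j : c ⟶ γ.apex)
    (hj : SubobjectCategory.Incl j) :
    ∃ (m : C) (w : m ⟶ c), IsIso w ∧ γ.app m = w ≫ j := by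
  obtain ⟨m, hm⟩ := γ.exists_isIso
  have := SubobjectCategory.incl_mono j hj
  let g : c ⟶ m := j ≫ inv (γ.app m)
  obtain ⟨k, hk, h⟩ := (fact g).isRetraction_q
  have hg : (fact g).q ≫ (fact g).u ≫ (fact g).j = g := (fact g).fac
  have hgm : Mono g := inferInstance
  have hq : Mono (fact g).q := by
    rw [← hg] at hgm
    exact mono_of_mono _ ((fact g).u ≫ (fact g).j)
  have hqi : IsIso (fact g).q := by
    refine ⟨k, ?_, h⟩
    rw [← cancel_mono (fact g).q, Category.assoc, h, Category.comp_id, Category.id_comp]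
  have hui := (fact g).isIso_u
  refine ⟨(fact g).im, inv ((fact g).q ≫ (fact g).u), inferInstance, ?_⟩
  rw [← γ.incl_app (fact g).j (fact g).incl_j, IsIso.eq_inv_comp]
  rw [← Category.assoc, Category.assoc (fact g).q, hg]
  simp [g]

/-- For a normal cone `γ` and a morphism `f` out of its apex, the normal cone `γ * f°` with
components `γ(c) ≫ f°`. -/
noncomputable def star (γ : NormalCone C) {d : C} (f : γ.apex ⟶ d) : NormalCone C where
  apex := im f
  app c := γ.app c ≫ epiPart f
  incl_app j hj := by rw [← Category.assoc, γ.incl_app j hj]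
  exists_isIso := by
    obtain ⟨c, j, hj, h⟩ := exists_incl_isIso f
    obtain ⟨m, w, hw, e⟩ := γ.exists_isIso_comp j hj
    refine ⟨m, ?_⟩
    rw [e, Category.assoc]
    infer_instance

/-- The inclusion of the apex of `γ * f°` in the codomain of `f`. -/
noncomputable def starIncl (γ : NormalCone C) {d : C} (f : γ.apex ⟶ d) :
    (γ.star f).apex ⟶ d := imIncl f

theorem incl_starIncl (γ : NormalCone C) {d : C} (f : γ.apex ⟶ d) :
    SubobjectCategory.Incl (γ.starIncl f) := incl_imIncl f

theorem star_app_starIncl (γ : NormalCone C) {d : C} (f : γ.apex ⟶ d) (c : C) :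
    (γ.star f).app c ≫ γ.starIncl f = γ.app c ≫ f := by
  change (γ.app c ≫ epiPart f) ≫ imIncl f = _
  rw [Category.assoc, epiPart_imIncl]

theorem exists_incl_of_comp_eq {γ δ : NormalCone C} {d : C} (f : γ.apex ⟶ d) (g : δ.apex ⟶ d)
    (h : ∀ c, γ.app c ≫ f = δ.app c ≫ g) :
    ∃ i : (γ.star f).apex ⟶ (δ.star g).apex,
      SubobjectCategory.Incl i ∧ i ≫ δ.starIncl g = γ.starIncl f := by
  obtain ⟨m, hm⟩ := (γ.star f).exists_isIso
  have e : (inv ((γ.star f).app m) ≫ (δ.star g).app m) ≫ δ.starIncl g = γ.starIncl f := by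
    rw [Category.assoc, star_app_starIncl, IsIso.inv_comp_eq, ← h, ← star_app_starIncl]
  refine ⟨_, SubobjectCategory.incl_of_comp _ _ ?_ (δ.incl_starIncl g), e⟩
  rw [e]
  exact γ.incl_starIncl f

theorem star_eq_star {γ δ : NormalCone C} {d : C} (f : γ.apex ⟶ d) (g : δ.apex ⟶ d)
    (h : ∀ c, γ.app c ≫ f = δ.app c ≫ g) : γ.star f = δ.star g := by
  obtain ⟨i, hi, ei⟩ := exists_incl_of_comp_eq f g h
  obtain ⟨k, hk, _⟩ := exists_incl_of_comp_eq g f (fun c => (h c).symm)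
  refine ext_of_incl i k hi hk fun c => ?_
  have := SubobjectCategory.incl_mono _ (δ.incl_starIncl g)
  rw [← cancel_mono (δ.starIncl g), star_app_starIncl, ← h, Category.assoc, ei,
    star_app_starIncl]

theorem comp_eq_of_star_eq {γ δ : NormalCone C} {d : C} (f : γ.apex ⟶ d) (g : δ.apex ⟶ d)
    (h : γ.star f = δ.star g) (c : C) : γ.app c ≫ f = δ.app c ≫ g := by
  have key : ∀ (α β : NormalCone C) (_ : α = β) (i : α.apex ⟶ d) (k : β.apex ⟶ d),
      SubobjectCategory.Incl i → SubobjectCategory.Incl k → α.app c ≫ i = β.app c ≫ k := by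
    rintro α _ rfl i k hi hk
    rw [SubobjectCategory.incl_unique i k hi hk]
  rw [← star_app_starIncl γ f, ← star_app_starIncl δ g]
  exact key _ _ h _ _ (γ.incl_starIncl f) (δ.incl_starIncl g)

theorem star_injective (γ : NormalCone C) {d : C} (f g : γ.apex ⟶ d)
    (h : γ.star f = γ.star g) : f = g := by
  obtain ⟨m, hm⟩ := γ.exists_isIso
  exact (cancel_epi (γ.app m)).1 (comp_eq_of_star_eq f g h m)

/-- The product of normal cones: `γ · δ = γ * (δ(c_γ))°`, with `c_γ` the apex of `γ`. -/
noncomputable instance : Mul (NormalCone C) := ⟨fun γ δ => γ.star (δ.app γ.apex)⟩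

end NormalCone

end Dual

/-- The category of subsets of a fixed set `U` and all maps between them.  Set-valued functors
take values here, so that it makes sense to say that one is contained in another. -/
structure SubsetCat (U : Type u) where
  carrier : Set U

instance (U : Type u) : Category (SubsetCat U) where
  Hom A B := A.carrier → B.carrier
  id _ := fun x => x
  comp f g := fun x => g (f x)

namespace SubsetCat

theorem eqToHom_val {U : Type u} {A B : SubsetCat U} (h : A = B) (x : A.carrier) :
    ((eqToHom h : A ⟶ B) x).1 = x.1 := by
  subst h
  rfl

theorem functor_ext {U : Type*} {C : Type*} [Category C] (F G : C ⥤ SubsetCat U)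
    (h : ∀ c x, x ∈ (F.obj c).carrier ↔ x ∈ (G.obj c).carrier)
    (hm : ∀ (c d : C) (k : c ⟶ d) (x : U) (hx : x ∈ (F.obj c).carrier)
      (hy : x ∈ (G.obj c).carrier), (F.map k ⟨x, hx⟩).1 = (G.map k ⟨x, hy⟩).1) : F = G := by
  have hobj : ∀ c, F.obj c = G.obj c := fun c => by
    have := Set.ext (h c)
    cases hF : F.obj c
    cases hG : G.obj c
    simp_all
  refine CategoryTheory.Functor.ext hobj fun c d k => ?_
  funext x
  apply Subtype.ext
  change (F.map k x).1 = ((eqToHom (hobj d).symm : G.obj d ⟶ F.obj d)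
    (G.map k ((eqToHom (hobj c) : F.obj c ⟶ G.obj c) x))).1
  have e : (eqToHom (hobj c) : F.obj c ⟶ G.obj c) x = ⟨x.1, (h c x.1).1 x.2⟩ :=
    Subtype.ext (eqToHom_val _ _)
  rw [eqToHom_val, e]
  exact hm c d k x.1 x.2 _

end SubsetCat

section Dual

variable {C : Type u} [Category.{v} C] [SubobjectCategory C] [NormalCategory C]

/-- The `H`-functor of a normal cone `γ`: `H(γ; c) = {γ * f° : f ∈ C(c_γ, c)}`, and `H(γ; g)` maps
`γ * f°` to `γ * (f ≫ g)°` (the morphism `f` is determined by `γ * f°`, see `star_injective`). -/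
noncomputable def H (γ : NormalCone C) : C ⥤ SubsetCat (NormalCone C) where
  obj c := ⟨Set.range fun f : γ.apex ⟶ c => γ.star f⟩
  map g := fun x => ⟨γ.star (x.2.choose ≫ g), _, rfl⟩
  map_id c := by
    funext x
    apply Subtype.ext
    change γ.star (x.2.choose ≫ 𝟙 c) = x.1
    rw [Category.comp_id]
    exact x.2.choose_spec
  map_comp {a b c} f g := by
    funext x
    apply Subtype.ext
    have hy : ∃ k : γ.apex ⟶ b, γ.star k = γ.star (x.2.choose ≫ f) := ⟨_, rfl⟩
    change γ.star (x.2.choose ≫ f ≫ g) = γ.star (hy.choose ≫ g)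
    rw [γ.star_injective _ _ hy.choose_spec, Category.assoc]

theorem H_map_star (γ : NormalCone C) {c d : C} (f : γ.apex ⟶ c) (g : c ⟶ d) :
    (H γ).map g ⟨γ.star f, f, rfl⟩ = ⟨γ.star (f ≫ g), _, rfl⟩ := by
  apply Subtype.ext
  have hy : ∃ k : γ.apex ⟶ c, γ.star k = γ.star f := ⟨_, rfl⟩
  change γ.star (hy.choose ≫ g) = γ.star (f ≫ g)
  rw [γ.star_injective _ _ hy.choose_spec]

/-- The natural isomorphism `η_γ : H(γ; -) ≅ C(c_γ, -)`, `γ * f° ↦ f`, at the object `c`. -/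
noncomputable def eta (γ : NormalCone C) (c : C) : ((H γ).obj c).carrier ≃ (γ.apex ⟶ c) where
  toFun x := x.2.choose
  invFun f := ⟨γ.star f, f, rfl⟩
  left_inv x := Subtype.ext x.2.choose_spec
  right_inv f :=
    have hy : ∃ k : γ.apex ⟶ c, γ.star k = γ.star f := ⟨_, rfl⟩
    γ.star_injective _ _ hy.choose_spec

theorem eta_map (γ : NormalCone C) {c d : C} (g : c ⟶ d) (x : ((H γ).obj c).carrier) :
    eta γ d ((H γ).map g x) = eta γ c x ≫ g := by
  obtain ⟨f, rfl⟩ := (eta γ c).symm.surjective x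
  rw [Equiv.apply_symm_apply]
  exact (congrArg (eta γ d) (H_map_star γ f g)).trans ((eta γ d).apply_symm_apply _)

/-- For `k : c_δ ⟶ c_γ` the natural transformation `η_γ ≫ C(k, -) ≫ η_δ⁻¹ : H(γ; -) ⟶ H(δ; -)`,
that is `γ * f° ↦ δ * (k ≫ f)°`. -/
noncomputable def HMap (γ δ : NormalCone C) (k : δ.apex ⟶ γ.apex) : H γ ⟶ H δ where
  app c := fun x => (eta δ c).symm (k ≫ eta γ c x)
  naturality c d g := by
    funext x
    apply (eta δ d).injective
    change eta δ d ((eta δ d).symm (k ≫ eta γ d ((H γ).map g x))) =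
      eta δ d ((H δ).map g ((eta δ c).symm (k ≫ eta γ c x)))
    rw [eta_map, eta_map, Equiv.apply_symm_apply, Equiv.apply_symm_apply, Category.assoc]

theorem HMap_star (γ δ : NormalCone C) (k : δ.apex ⟶ γ.apex) {c : C} (f : γ.apex ⟶ c) :
    (HMap γ δ k).app c ⟨γ.star f, f, rfl⟩ = ⟨δ.star (k ≫ f), _, rfl⟩ := by
  change (eta δ c).symm (k ≫ eta γ c ((eta γ c).symm f)) = (eta δ c).symm (k ≫ f)
  rw [Equiv.apply_symm_apply]

theorem HMap_eq_id (γ : NormalCone C) (k : γ.apex ⟶ γ.apex) (h : k = 𝟙 _) :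
    HMap γ γ k = 𝟙 (H γ) := by
  subst h
  ext c
  funext x
  change (eta γ c).symm (𝟙 _ ≫ eta γ c x) = x
  rw [Category.id_comp, Equiv.symm_apply_apply]

theorem HMap_eq_comp (γ δ ε : NormalCone C) (k : δ.apex ⟶ γ.apex) (l : ε.apex ⟶ δ.apex)
    (m : ε.apex ⟶ γ.apex) (h : m = l ≫ k) : HMap γ ε m = HMap γ δ k ≫ HMap δ ε l := by
  subst h
  ext c
  funext x
  change (eta ε c).symm ((l ≫ k) ≫ eta γ c x) =
    (eta ε c).symm (l ≫ eta δ c ((eta δ c).symm (k ≫ eta γ c x)))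
  rw [Equiv.apply_symm_apply, Category.assoc]

theorem H_eq_H {γ δ : NormalCone C} (k : δ.apex ⟶ γ.apex) (l : γ.apex ⟶ δ.apex)
    (hk : ∀ c, δ.app c ≫ k = γ.app c) (hl : ∀ c, γ.app c ≫ l = δ.app c) : H γ = H δ := by
  have e1 : ∀ {c : C} (f : γ.apex ⟶ c), γ.star f = δ.star (k ≫ f) := fun f =>
    NormalCone.star_eq_star _ _ fun c => by rw [← Category.assoc, hk]
  have e2 : ∀ {c : C} (f : δ.apex ⟶ c), δ.star f = γ.star (l ≫ f) := fun f =>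
    NormalCone.star_eq_star _ _ fun c => by rw [← Category.assoc, hl]
  refine SubsetCat.functor_ext _ _ (fun c x => ⟨?_, ?_⟩) ?_
  · rintro ⟨f, rfl⟩
    exact ⟨k ≫ f, (e1 f).symm⟩
  · rintro ⟨f, rfl⟩
    exact ⟨l ≫ f, (e2 f).symm⟩
  · rintro c d g _ ⟨f, rfl⟩ hy
    have h2 : (⟨γ.star f, hy⟩ : ((H δ).obj c).carrier) = ⟨δ.star (k ≫ f), _, rfl⟩ :=
      Subtype.ext (e1 f)
    rw [h2]
    refine (congrArg Subtype.val (H_map_star γ f g)).trans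
      (Eq.trans ?_ (congrArg Subtype.val (H_map_star δ (k ≫ f) g)).symm)
    change γ.star (f ≫ g) = δ.star ((k ≫ f) ≫ g)
    rw [e1, Category.assoc]

theorem NormalCone.isIdempotentElem_of_app_apex (γ : NormalCone C) (h : γ.app γ.apex = 𝟙 _) :
    IsIdempotentElem γ := by
  change γ.star (γ.app γ.apex) = γ
  rw [h]
  have e : epiPart (𝟙 γ.apex) ≫ imIncl (𝟙 γ.apex) = 𝟙 γ.apex := epiPart_imIncl _
  refine NormalCone.ext_of_incl (γ.starIncl (𝟙 γ.apex)) (epiPart (𝟙 γ.apex))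
    (γ.incl_starIncl _) (SubobjectCategory.incl_of_comp _ (imIncl (𝟙 γ.apex)) ?_ (incl_imIncl _))
    fun c => ?_
  · exact Eq.mpr (congrArg (fun t => SubobjectCategory.Incl t) e) (SubobjectCategory.incl_id _)
  · rw [γ.star_app_starIncl, Category.comp_id]

variable (C)

/-- The normal dual `N*C`: the full subcategory of the category of set-valued functors on `C` whose
objects are the `H(ε; -)` for idempotent normal cones `ε`. -/
abbrev NormalDual : Type _ :=
  ObjectProperty.FullSubcategory fun F : C ⥤ SubsetCat (NormalCone C) =>
    ∃ ε : NormalCone C, IsIdempotentElem ε ∧ F = H ε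

/-- The inclusions of the normal dual are the inclusions of subfunctors. -/
instance : SubobjectCategory (NormalDual C) where
  Incl {F G} η := ∀ (c : C) (x : (F.obj.obj c).carrier),
    ((η.hom.app c x : (G.obj.obj c).carrier) : NormalCone C) = x
  incl_id _ _ _ := rfl
  incl_comp f g hf hg c x := (hg c (f.hom.app c x)).trans (hf c x)
  incl_unique f g hf hg := by
    apply ObjectProperty.hom_ext
    ext c
    funext x
    exact Subtype.ext ((hf c x).trans (hg c x).symm)
  incl_antisymm {F G} f g hf hg := by
    obtain ⟨F, _⟩ := F
    obtain ⟨G, _⟩ := G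
    congr 1
    refine SubsetCat.functor_ext F G (fun c x => ⟨fun hx => ?_, fun hx => ?_⟩)
      fun c d k x hx hy => ?_
    · rw [← show _ = x from hf c ⟨x, hx⟩]
      exact Subtype.property _
    · rw [← show _ = x from hg c ⟨x, hx⟩]
      exact Subtype.property _
    · rw [← hf d (F.map k ⟨x, hx⟩), ← show f.hom.app c ⟨x, hx⟩ = ⟨x, hy⟩ from
        Subtype.ext (hf c ⟨x, hx⟩)]
      exact congrArg Subtype.val (congrFun (f.hom.naturality k) ⟨x, hx⟩)
  incl_mono f hf := ⟨fun g h e => by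
    apply ObjectProperty.hom_ext
    ext c
    funext x
    apply Subtype.ext
    have e' := congrArg Subtype.val (congrFun (congrArg (fun t => t.hom.app c) e) x)
    exact ((hf c (g.hom.app c x)).symm.trans e').trans (hf c (h.hom.app c x))⟩
  incl_of_comp h g hhg hg c x := (hg c (h.hom.app c x)).symm.trans (hhg c x)

end Dual


/-- A (von Neumann) regular semigroup. -/
class RegularSemigroup (S : Type u) [Semigroup S] : Prop where
  exists_inner : ∀ a : S, ∃ b : S, a * b * a = a

/-- A semilattice: a commutative semigroup of idempotents. -/
class IsSemilattice (S : Type u) [Semigroup S] : Prop where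
  mul_comm : ∀ a b : S, a * b = b * a
  mul_self : ∀ a : S, a * a = a

instance (S : Type u) [Semigroup S] [IsSemilattice S] : RegularSemigroup S where
  exists_inner a := ⟨a, by rw [IsSemilattice.mul_self, IsSemilattice.mul_self]⟩

/-! ## The normal category `L(S)` of principal left ideals of a regular semigroup -/

/-- The principal left ideals `Se`, `e` an idempotent: the objects of `L(S)`. -/
structure LCat (S : Type u) [Semigroup S] where
  carrier : Set S
  exists_idem : ∃ e : S, IsIdempotentElem e ∧ carrier = Set.range fun s : S => s * e

namespace LCat

section Basic

variable {S : Type u} [Semigroup S]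

theorem ext_carrier {I J : LCat S} (h : I.carrier = J.carrier) : I = J := by
  cases I; cases J; simp_all

/-- The object `Se`. -/
def ofIdem (e : S) (he : IsIdempotentElem e) : LCat S :=
  ⟨Set.range fun s : S => s * e, e, he, rfl⟩

/-- `φ` is the map `ρ(e, u, f) : x ↦ x * u` from `I = Se` to `J = Sf`, where `u ∈ eSf`. -/
def IsTranslation {I J : LCat S} (φ : I.carrier → J.carrier) (e u f : S) : Prop :=
  IsIdempotentElem e ∧ IsIdempotentElem f ∧ I.carrier = (Set.range fun s : S => s * e) ∧
    J.carrier = (Set.range fun s : S => s * f) ∧ (∃ s : S, u = e * s * f) ∧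
    ∀ x : I.carrier, (φ x : S) = x * u

/-- Morphisms are the partial right translations `ρ(e, u, f)`. -/
@[ext]
structure Hom (I J : LCat S) where
  toFun : I.carrier → J.carrier
  isTranslation : ∃ e u f : S, IsTranslation toFun e u f

theorem mem_iff {I : LCat S} {e : S} (he : IsIdempotentElem e)
    (hI : I.carrier = Set.range fun s : S => s * e) {x : S} : x ∈ I.carrier ↔ x * e = x := by
  have hm := mul_assoc (G := S)
  rw [hI]
  constructor
  · rintro ⟨s, rfl⟩
    have := he.eq
    grind
  · intro h
    exact ⟨x, h⟩

theorem exists_translation {I J : LCat S} (φ : I.carrier → J.carrier) (u : S)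
    (h : ∀ x, (φ x : S) = x * u) : ∃ e u f : S, IsTranslation φ e u f := by
  have hm := mul_assoc (G := S)
  obtain ⟨e, he, hI⟩ := I.exists_idem
  obtain ⟨f, hf, hJ⟩ := J.exists_idem
  have heI : e ∈ I.carrier := (mem_iff he hI).2 he
  refine ⟨e, e * u, f, he, hf, hI, hJ, ⟨u, ?_⟩, fun x => ?_⟩
  · have := (mem_iff hf hJ).1 (φ ⟨e, heI⟩).2
    rw [h] at this
    grind
  · have := (mem_iff he hI).1 x.2
    rw [h]
    grind

/-- The map `x ↦ x * u` from `I` to `J`, provided that it maps `I` into `J`. -/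
def homOf (I J : LCat S) (u : S) (h : ∀ x ∈ I.carrier, x * u ∈ J.carrier) : Hom I J :=
  ⟨fun x => ⟨x.1 * u, h x.1 x.2⟩, exists_translation _ u fun _ => rfl⟩

/-- Composition of morphisms is composition of maps, in diagrammatic order. -/
instance : Category (LCat S) where
  Hom := Hom
  id I := ⟨fun x => x, by
    obtain ⟨e, he, hI⟩ := I.exists_idem
    exact exists_translation _ e fun x => ((mem_iff he hI).1 x.2).symm⟩
  comp φ ψ := ⟨fun x => ψ.toFun (φ.toFun x), by
    have hm := mul_assoc (G := S)
    obtain ⟨_, u, _, _, _, _, _, _, hu⟩ := φ.isTranslation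
    obtain ⟨_, v, _, _, _, _, _, _, hv⟩ := ψ.isTranslation
    exact exists_translation _ (u * v) fun x => by rw [hv, hu]; grind⟩

theorem hom_ext {I J : LCat S} {φ ψ : I ⟶ J} (h : ∀ x, (φ.toFun x : S) = ψ.toFun x) : φ = ψ :=
  Hom.ext (funext fun x => Subtype.ext (h x))

theorem comp_toFun {I J K : LCat S} (φ : I ⟶ J) (ψ : J ⟶ K) (x : I.carrier) :
    (φ ≫ ψ).toFun x = ψ.toFun (φ.toFun x) := rfl

/-- The inclusions are the set inclusions of ideals. -/
instance : SubobjectCategory (LCat S) where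
  Incl {I J} φ := ∀ x : I.carrier, (φ.toFun x : S) = x
  incl_id _ _ := rfl
  incl_comp f g hf hg x := (hg (f.toFun x)).trans (hf x)
  incl_unique f g hf hg := hom_ext fun x => (hf x).trans (hg x).symm
  incl_antisymm f g hf hg := ext_carrier (Set.Subset.antisymm
    (fun x hx => by rw [← show _ = x from hf ⟨x, hx⟩]; exact (f.toFun ⟨x, hx⟩).2)
    (fun x hx => by rw [← show _ = x from hg ⟨x, hx⟩]; exact (g.toFun ⟨x, hx⟩).2))
  incl_mono f hf := ⟨fun g h e => hom_ext fun x => by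
    have e' : (f.toFun (g.toFun x) : S) = f.toFun (h.toFun x) := by
      rw [← comp_toFun, e, comp_toFun]
    rwa [hf, hf] at e'⟩
  incl_of_comp h g hhg hg x := (hg (h.toFun x)).symm.trans (hhg x)

theorem eqToHom_toFun {I J : LCat S} (h : I = J) (x : I.carrier) :
    ((eqToHom h).toFun x : S) = x := by
  subst h
  rfl

/-- The morphism `ρ(e, u, f) : Se ⟶ Sf`, `x ↦ x * u`, for `u ∈ eSf`. -/
def rho (e u f : S) (he : IsIdempotentElem e) (hf : IsIdempotentElem f)
    (hu : ∃ s, u = e * s * f) : ofIdem e he ⟶ ofIdem f hf :=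
  homOf _ _ u fun x _ => by
    obtain ⟨s, rfl⟩ := hu
    exact ⟨x * (e * s), by simp only [mul_assoc]⟩

/-- A chosen idempotent generator of the ideal `I`. -/
noncomputable def gen (I : LCat S) : S := I.exists_idem.choose

theorem isIdem_gen (I : LCat S) : IsIdempotentElem I.gen := I.exists_idem.choose_spec.1

theorem carrier_eq (I : LCat S) : I.carrier = Set.range fun s : S => s * I.gen :=
  I.exists_idem.choose_spec.2

theorem gen_mem (I : LCat S) : I.gen ∈ I.carrier := (mem_iff I.isIdem_gen I.carrier_eq).2 I.isIdem_gen

theorem toFun_eq {I J : LCat S} (φ : I ⟶ J) {e : S} (he : IsIdempotentElem e)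
    (hI : I.carrier = Set.range fun s : S => s * e) (h : e ∈ I.carrier) (x : I.carrier) :
    (φ.toFun x : S) = x * (φ.toFun ⟨e, h⟩).1 := by
  have hm := mul_assoc (G := S)
  obtain ⟨_, u, _, _, _, _, _, _, hu⟩ := φ.isTranslation
  have := (mem_iff he hI).1 x.2
  rw [hu, hu]
  grind

theorem exists_toFun_eq {I J : LCat S} (φ : I ⟶ J) {e f : S} (he : IsIdempotentElem e)
    (hf : IsIdempotentElem f) (h : e ∈ I.carrier)
    (hJ : J.carrier = Set.range fun s : S => s * f) :
    ∃ s : S, (φ.toFun ⟨e, h⟩).1 = e * s * f := by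
  have hm := mul_assoc (G := S)
  obtain ⟨_, u, _, _, _, _, _, _, hu⟩ := φ.isTranslation
  have h1 := (mem_iff hf hJ).1 (φ.toFun ⟨e, h⟩).2
  have h2 := he.eq
  refine ⟨(φ.toFun ⟨e, h⟩).1, ?_⟩
  rw [hu] at h1 ⊢
  change (e * u) * f = e * u at h1
  change e * u = e * (e * u) * f
  grind

end Basic

variable {S : Type u} [Semigroup S] [RegularSemigroup S]

/-- The principal cone `ρ^a`: its apex is `Sa`, and its component at `Se` is the map `x ↦ x * a`,
that is `ρ(e, ea, f)` where `f` is an idempotent with `Sf = Sa`. -/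
def principalCone (a : S) : NormalCone (LCat S) where
  apex := ⟨Set.range fun s : S => s * a, by
    have hm := mul_assoc (G := S)
    obtain ⟨b, hb⟩ := RegularSemigroup.exists_inner a
    refine ⟨b * a, by change (b * a) * (b * a) = b * a; grind, ?_⟩
    ext x
    constructor
    · rintro ⟨s, rfl⟩
      exact ⟨s * a, by grind⟩
    · rintro ⟨s, rfl⟩
      exact ⟨s * b, by grind⟩⟩
  app I := homOf I _ a fun x _ => ⟨x, rfl⟩
  incl_app j hj := hom_ext fun x => by
    change (j.toFun x).1 * a = x.1 * a
    rw [hj]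
  exists_isIso := by
    have hm := mul_assoc (G := S)
    obtain ⟨b, hb⟩ := RegularSemigroup.exists_inner a
    have he : IsIdempotentElem (a * b) := by
      change (a * b) * (a * b) = a * b
      grind
    refine ⟨ofIdem _ he, homOf _ _ b ?_, ?_, ?_⟩
    · rintro _ ⟨s, rfl⟩
      exact ⟨s, by grind⟩
    · refine hom_ext fun x => ?_
      have := (mem_iff he rfl).1 x.2
      change (x.1 * a) * b = x.1
      grind
    · refine hom_ext ?_
      rintro ⟨_, s, rfl⟩
      change ((s * a) * b) * a = s * a
      grind

theorem exists_normalFactorization {I J : LCat S} (φ : I ⟶ J) :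
    Nonempty (NormalFactorization φ) := by
  have hm := mul_assoc (G := S)
  obtain ⟨e, u, f, he, hf, hI, hJ, ⟨s, hs⟩, hu⟩ := φ.isTranslation
  have hee := he.eq
  have hff := hf.eq
  have heu : e * u = u := by grind
  have huf : u * f = u := by grind
  obtain ⟨b, hb⟩ := RegularSemigroup.exists_inner u
  have hg : IsIdempotentElem (u * b * e) := by
    change (u * b * e) * (u * b * e) = u * b * e
    grind
  have hh : IsIdempotentElem (b * u) := by
    change (b * u) * (b * u) = b * u
    grind
  refine ⟨⟨ofIdem _ hg, ofIdem _ hh, homOf _ _ (u * b * e) ?_, homOf _ _ u ?_,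
    homOf _ _ f ?_, ⟨homOf _ _ e ?_, ?_, ?_⟩, ⟨homOf _ _ (b * e) ?_, ?_, ?_⟩, ?_, ?_⟩⟩
  · intro x _
    exact ⟨x, rfl⟩
  · rintro _ ⟨x, rfl⟩
    exact ⟨x * u * b * e * u, by grind⟩
  · rintro _ ⟨x, rfl⟩
    rw [mem_iff hf hJ]
    grind
  · rintro _ ⟨x, rfl⟩
    rw [mem_iff he hI]
    grind
  · rintro ⟨_, x, rfl⟩
    change (x * (u * b * e)) * e = x * (u * b * e)
    grind
  · refine hom_ext ?_
    rintro ⟨_, x, rfl⟩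
    change ((x * (u * b * e)) * e) * (u * b * e) = x * (u * b * e)
    grind
  · rintro _ ⟨x, rfl⟩
    exact ⟨x * b, by grind⟩
  · refine hom_ext ?_
    rintro ⟨_, x, rfl⟩
    change ((x * (u * b * e)) * u) * (b * e) = x * (u * b * e)
    grind
  · refine hom_ext ?_
    rintro ⟨_, x, rfl⟩
    change ((x * (b * u)) * (b * e)) * u = x * (b * u)
    grind
  · rintro ⟨_, x, rfl⟩
    change (x * (b * u)) * f = x * (b * u)
    grind
  · refine hom_ext fun x => ?_
    have := (mem_iff he hI).1 x.2
    rw [hu]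
    change ((x.1 * (u * b * e)) * u) * f = x.1 * u
    grind

instance : NormalCategory (LCat S) where
  incl_splits {I J} j hj := by
    obtain ⟨e, he, hI⟩ := I.exists_idem
    refine ⟨homOf _ _ e fun x _ => by rw [hI]; exact ⟨x, rfl⟩, hom_ext fun x => ?_⟩
    change (j.toFun x).1 * e = x.1
    rw [hj]
    exact (mem_iff he hI).1 x.2
  exists_factorization := exists_normalFactorization
  exists_cone I := by
    obtain ⟨e, he, hI⟩ := I.exists_idem
    refine ⟨principalCone e, ext_carrier hI.symm, hom_ext fun x => ?_⟩
    rw [comp_toFun, eqToHom_toFun]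
    exact (mem_iff he hI).1 x.2

theorem isIdempotentElem_principalCone {e : S} (he : IsIdempotentElem e) :
    IsIdempotentElem (principalCone e) :=
  NormalCone.isIdempotentElem_of_app_apex _ (hom_ext fun x => (mem_iff he rfl).1 x.2)

end LCat

/-! ## The normal category `R(S)` of principal right ideals of a regular semigroup -/

/-- The principal right ideals `eS`, `e` an idempotent: the objects of `R(S)`. -/
structure RCat (S : Type u) [Semigroup S] where
  carrier : Set S
  exists_idem : ∃ e : S, IsIdempotentElem e ∧ carrier = Set.range fun s : S => e * s

namespace RCat

section Basic

variable {S : Type u} [Semigroup S]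

theorem ext_carrier {I J : RCat S} (h : I.carrier = J.carrier) : I = J := by
  cases I; cases J; simp_all

/-- The object `eS`. -/
def ofIdem (e : S) (he : IsIdempotentElem e) : RCat S :=
  ⟨Set.range fun s : S => e * s, e, he, rfl⟩

/-- `φ` is the map `κ(e, u, f) : x ↦ u * x` from `I = eS` to `J = fS`, where `u ∈ fSe`. -/
def IsTranslation {I J : RCat S} (φ : I.carrier → J.carrier) (e u f : S) : Prop :=
  IsIdempotentElem e ∧ IsIdempotentElem f ∧ I.carrier = (Set.range fun s : S => e * s) ∧
    J.carrier = (Set.range fun s : S => f * s) ∧ (∃ s : S, u = f * s * e) ∧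
    ∀ x : I.carrier, (φ x : S) = u * x

/-- Morphisms are the partial left translations `κ(e, u, f)`. -/
@[ext]
structure Hom (I J : RCat S) where
  toFun : I.carrier → J.carrier
  isTranslation : ∃ e u f : S, IsTranslation toFun e u f

theorem mem_iff {I : RCat S} {e : S} (he : IsIdempotentElem e)
    (hI : I.carrier = Set.range fun s : S => e * s) {x : S} : x ∈ I.carrier ↔ e * x = x := by
  have hm := mul_assoc (G := S)
  rw [hI]
  constructor
  · rintro ⟨s, rfl⟩
    have := he.eq
    grind
  · intro h
    exact ⟨x, h⟩

theorem exists_translation {I J : RCat S} (φ : I.carrier → J.carrier) (u : S)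
    (h : ∀ x, (φ x : S) = u * x) : ∃ e u f : S, IsTranslation φ e u f := by
  have hm := mul_assoc (G := S)
  obtain ⟨e, he, hI⟩ := I.exists_idem
  obtain ⟨f, hf, hJ⟩ := J.exists_idem
  have heI : e ∈ I.carrier := (mem_iff he hI).2 he
  refine ⟨e, u * e, f, he, hf, hI, hJ, ⟨u, ?_⟩, fun x => ?_⟩
  · have := (mem_iff hf hJ).1 (φ ⟨e, heI⟩).2
    rw [h] at this
    grind
  · have := (mem_iff he hI).1 x.2
    rw [h]
    grind

/-- The map `x ↦ u * x` from `I` to `J`, provided that it maps `I` into `J`. -/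
def homOf (I J : RCat S) (u : S) (h : ∀ x ∈ I.carrier, u * x ∈ J.carrier) : Hom I J :=
  ⟨fun x => ⟨u * x.1, h x.1 x.2⟩, exists_translation _ u fun _ => rfl⟩

/-- Composition of morphisms is composition of maps, in diagrammatic order. -/
instance : Category (RCat S) where
  Hom := Hom
  id I := ⟨fun x => x, by
    obtain ⟨e, he, hI⟩ := I.exists_idem
    exact exists_translation _ e fun x => ((mem_iff he hI).1 x.2).symm⟩
  comp φ ψ := ⟨fun x => ψ.toFun (φ.toFun x), by
    have hm := mul_assoc (G := S)
    obtain ⟨_, u, _, _, _, _, _, _, hu⟩ := φ.isTranslation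
    obtain ⟨_, v, _, _, _, _, _, _, hv⟩ := ψ.isTranslation
    exact exists_translation _ (v * u) fun x => by rw [hv, hu]; grind⟩

theorem hom_ext {I J : RCat S} {φ ψ : I ⟶ J} (h : ∀ x, (φ.toFun x : S) = ψ.toFun x) : φ = ψ :=
  Hom.ext (funext fun x => Subtype.ext (h x))

theorem comp_toFun {I J K : RCat S} (φ : I ⟶ J) (ψ : J ⟶ K) (x : I.carrier) :
    (φ ≫ ψ).toFun x = ψ.toFun (φ.toFun x) := rfl

/-- The inclusions are the set inclusions of ideals. -/
instance : SubobjectCategory (RCat S) where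
  Incl {I J} φ := ∀ x : I.carrier, (φ.toFun x : S) = x
  incl_id _ _ := rfl
  incl_comp f g hf hg x := (hg (f.toFun x)).trans (hf x)
  incl_unique f g hf hg := hom_ext fun x => (hf x).trans (hg x).symm
  incl_antisymm f g hf hg := ext_carrier (Set.Subset.antisymm
    (fun x hx => by rw [← show _ = x from hf ⟨x, hx⟩]; exact (f.toFun ⟨x, hx⟩).2)
    (fun x hx => by rw [← show _ = x from hg ⟨x, hx⟩]; exact (g.toFun ⟨x, hx⟩).2))
  incl_mono f hf := ⟨fun g h e => hom_ext fun x => by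
    have e' : (f.toFun (g.toFun x) : S) = f.toFun (h.toFun x) := by
      rw [← comp_toFun, e, comp_toFun]
    rwa [hf, hf] at e'⟩
  incl_of_comp h g hhg hg x := (hg (h.toFun x)).symm.trans (hhg x)

theorem eqToHom_toFun {I J : RCat S} (h : I = J) (x : I.carrier) :
    ((eqToHom h).toFun x : S) = x := by
  subst h
  rfl

/-- The morphism `κ(e, u, f) : eS ⟶ fS`, `x ↦ u * x`, for `u ∈ fSe`. -/
def kappa (e u f : S) (he : IsIdempotentElem e) (hf : IsIdempotentElem f)
    (hu : ∃ s, u = f * s * e) : ofIdem e he ⟶ ofIdem f hf :=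
  homOf _ _ u fun x _ => by
    obtain ⟨s, rfl⟩ := hu
    exact ⟨(s * e) * x, by simp only [mul_assoc]⟩

/-- A chosen idempotent generator of the ideal `I`. -/
noncomputable def gen (I : RCat S) : S := I.exists_idem.choose

theorem isIdem_gen (I : RCat S) : IsIdempotentElem I.gen := I.exists_idem.choose_spec.1

theorem carrier_eq (I : RCat S) : I.carrier = Set.range fun s : S => I.gen * s :=
  I.exists_idem.choose_spec.2

theorem gen_mem (I : RCat S) : I.gen ∈ I.carrier := (mem_iff I.isIdem_gen I.carrier_eq).2 I.isIdem_gen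

theorem toFun_eq {I J : RCat S} (φ : I ⟶ J) {e : S} (he : IsIdempotentElem e)
    (hI : I.carrier = Set.range fun s : S => e * s) (h : e ∈ I.carrier) (x : I.carrier) :
    (φ.toFun x : S) = (φ.toFun ⟨e, h⟩).1 * x := by
  have hm := mul_assoc (G := S)
  obtain ⟨_, u, _, _, _, _, _, _, hu⟩ := φ.isTranslation
  have := (mem_iff he hI).1 x.2
  rw [hu, hu]
  grind

theorem exists_toFun_eq {I J : RCat S} (φ : I ⟶ J) {e f : S} (he : IsIdempotentElem e)
    (hf : IsIdempotentElem f) (h : e ∈ I.carrier)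
    (hJ : J.carrier = Set.range fun s : S => f * s) :
    ∃ s : S, (φ.toFun ⟨e, h⟩).1 = f * s * e := by
  have hm := mul_assoc (G := S)
  obtain ⟨_, u, _, _, _, _, _, _, hu⟩ := φ.isTranslation
  have h1 := (mem_iff hf hJ).1 (φ.toFun ⟨e, h⟩).2
  have h2 := he.eq
  refine ⟨(φ.toFun ⟨e, h⟩).1, ?_⟩
  rw [hu] at h1 ⊢
  change f * (u * e) = u * e at h1
  change u * e = f * (u * e) * e
  grind

end Basic

variable {S : Type u} [Semigroup S] [RegularSemigroup S]

/-- The principal cone `λ^a`: its apex is `aS`, and its component at `eS` is the map `x ↦ a * x`,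
that is `κ(e, ae, f)` where `f` is an idempotent with `fS = aS`. -/
def principalCone (a : S) : NormalCone (RCat S) where
  apex := ⟨Set.range fun s : S => a * s, by
    have hm := mul_assoc (G := S)
    obtain ⟨b, hb⟩ := RegularSemigroup.exists_inner a
    refine ⟨a * b, by change (a * b) * (a * b) = a * b; grind, ?_⟩
    ext x
    constructor
    · rintro ⟨s, rfl⟩
      exact ⟨a * s, by grind⟩
    · rintro ⟨s, rfl⟩
      exact ⟨b * s, by grind⟩⟩
  app I := homOf I _ a fun x _ => ⟨x, rfl⟩
  incl_app j hj := hom_ext fun x => by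
    change a * (j.toFun x).1 = a * x.1
    rw [hj]
  exists_isIso := by
    have hm := mul_assoc (G := S)
    obtain ⟨b, hb⟩ := RegularSemigroup.exists_inner a
    have he : IsIdempotentElem (b * a) := by
      change (b * a) * (b * a) = b * a
      grind
    refine ⟨ofIdem _ he, homOf _ _ b ?_, ?_, ?_⟩
    · rintro _ ⟨s, rfl⟩
      exact ⟨s, by grind⟩
    · refine hom_ext fun x => ?_
      have := (mem_iff he rfl).1 x.2
      change b * (a * x.1) = x.1
      grind
    · refine hom_ext ?_
      rintro ⟨_, s, rfl⟩
      change a * (b * (a * s)) = a * s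
      grind

theorem exists_normalFactorization {I J : RCat S} (φ : I ⟶ J) :
    Nonempty (NormalFactorization φ) := by
  have hm := mul_assoc (G := S)
  obtain ⟨e, u, f, he, hf, hI, hJ, ⟨s, hs⟩, hu⟩ := φ.isTranslation
  have hee := he.eq
  have hff := hf.eq
  have heu : u * e = u := by grind
  have huf : f * u = u := by grind
  obtain ⟨b, hb⟩ := RegularSemigroup.exists_inner u
  have hg : IsIdempotentElem (e * b * u) := by
    change (e * b * u) * (e * b * u) = e * b * u
    grind
  have hh : IsIdempotentElem (u * b) := by
    change (u * b) * (u * b) = u * b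
    grind
  refine ⟨⟨ofIdem _ hg, ofIdem _ hh, homOf _ _ (e * b * u) ?_, homOf _ _ u ?_,
    homOf _ _ f ?_, ⟨homOf _ _ e ?_, ?_, ?_⟩, ⟨homOf _ _ (e * b) ?_, ?_, ?_⟩, ?_, ?_⟩⟩
  · intro x _
    exact ⟨x, rfl⟩
  · rintro _ ⟨x, rfl⟩
    exact ⟨u * e * b * u * x, by grind⟩
  · rintro _ ⟨x, rfl⟩
    rw [mem_iff hf hJ]
    grind
  · rintro _ ⟨x, rfl⟩
    rw [mem_iff he hI]
    grind
  · rintro ⟨_, x, rfl⟩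
    change e * ((e * b * u) * x) = (e * b * u) * x
    grind
  · refine hom_ext ?_
    rintro ⟨_, x, rfl⟩
    change (e * b * u) * (e * ((e * b * u) * x)) = (e * b * u) * x
    grind
  · rintro _ ⟨x, rfl⟩
    exact ⟨b * x, by grind⟩
  · refine hom_ext ?_
    rintro ⟨_, x, rfl⟩
    change (e * b) * (u * ((e * b * u) * x)) = (e * b * u) * x
    grind
  · refine hom_ext ?_
    rintro ⟨_, x, rfl⟩
    change u * ((e * b) * ((u * b) * x)) = (u * b) * x
    grind
  · rintro ⟨_, x, rfl⟩
    change f * ((u * b) * x) = (u * b) * x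
    grind
  · refine hom_ext fun x => ?_
    have := (mem_iff he hI).1 x.2
    rw [hu]
    change f * (u * ((e * b * u) * x.1)) = u * x.1
    grind

instance : NormalCategory (RCat S) where
  incl_splits {I J} j hj := by
    obtain ⟨e, he, hI⟩ := I.exists_idem
    refine ⟨homOf _ _ e fun x _ => by rw [hI]; exact ⟨x, rfl⟩, hom_ext fun x => ?_⟩
    change e * (j.toFun x).1 = x.1
    rw [hj]
    exact (mem_iff he hI).1 x.2
  exists_factorization := exists_normalFactorization
  exists_cone I := by
    obtain ⟨e, he, hI⟩ := I.exists_idem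
    refine ⟨principalCone e, ext_carrier hI.symm, hom_ext fun x => ?_⟩
    rw [comp_toFun, eqToHom_toFun]
    exact (mem_iff he hI).1 x.2

theorem isIdempotentElem_principalCone {e : S} (he : IsIdempotentElem e) :
    IsIdempotentElem (principalCone e) :=
  NormalCone.isIdempotentElem_of_app_apex _ (hom_ext fun x => (mem_iff he rfl).1 x.2)

end RCat

/-! ## The functors `Γ` and `Δ` -/

section Connections

variable (S : Type u) [Semigroup S] [RegularSemigroup S]

/-- The cross-connection functor `Γ : R(S) ⥤ N*L(S)` of the regular semigroup `S`:
`Γ(eS) = H(ρ^e; -)`, and `Γ(κ(e, u, f)) = η_{ρ^e} ≫ L(S)(ρ(f, u, e), -) ≫ η_{ρ^f}⁻¹`, that is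
`ρ^e * g° ↦ ρ^f * (ρ(f, u, e) ≫ g)°`.  The idempotent `e` with `I = eS` is chosen; `Gamma_obj` and
`Gamma_map` show that the functor does not depend on the choices. -/
noncomputable def Gamma : RCat S ⥤ NormalDual (LCat S) where
  obj I := ⟨H (LCat.principalCone I.gen), _, LCat.isIdempotentElem_principalCone I.isIdem_gen, rfl⟩
  map {I J} φ := ObjectProperty.homMk (HMap _ _ (LCat.rho J.gen (φ.toFun ⟨I.gen, I.gen_mem⟩).1 I.gen
    J.isIdem_gen I.isIdem_gen (RCat.exists_toFun_eq φ I.isIdem_gen J.isIdem_gen I.gen_mem J.carrier_eq)))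
  map_id I := by
    apply ObjectProperty.hom_ext
    refine HMap_eq_id _ _ (LCat.hom_ext fun x => ?_)
    exact (LCat.mem_iff I.isIdem_gen rfl).1 x.2
  map_comp {I J K} φ ψ := by
    have hm := mul_assoc (G := S)
    apply ObjectProperty.hom_ext
    refine HMap_eq_comp _ _ _ _ _ _ (LCat.hom_ext fun x => ?_)
    have h := RCat.toFun_eq ψ J.isIdem_gen J.carrier_eq J.gen_mem (φ.toFun ⟨I.gen, I.gen_mem⟩)
    change x.1 * (ψ.toFun (φ.toFun ⟨I.gen, I.gen_mem⟩)).1 =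
      (x.1 * (ψ.toFun ⟨J.gen, J.gen_mem⟩).1) * (φ.toFun ⟨I.gen, I.gen_mem⟩).1
    rw [h]
    grind

/-- `Γ(eS) = H(ρ^e; -)` for every idempotent `e`. -/
theorem Gamma_obj (e : S) (he : IsIdempotentElem e) :
    ((Gamma S).obj (RCat.ofIdem e he)).obj = H (LCat.principalCone e) := by
  have hm := mul_assoc (G := S)
  let I := RCat.ofIdem e he
  have h1 : e * I.gen = I.gen := (RCat.mem_iff he rfl).1 I.gen_mem
  have h2 : I.gen * e = e := (RCat.mem_iff I.isIdem_gen I.carrier_eq).1 ((RCat.mem_iff he rfl).2 he)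
  refine H_eq_H (LCat.homOf _ _ I.gen fun x _ => ⟨x, rfl⟩)
    (LCat.homOf _ _ e fun x _ => ⟨x, rfl⟩) (fun c => LCat.hom_ext fun x => ?_)
    (fun c => LCat.hom_ext fun x => ?_)
  · change (x.1 * e) * I.gen = x.1 * I.gen
    grind
  · change (x.1 * I.gen) * e = x.1 * e
    grind

/-- `Γ(κ(e, u, f))` maps `ρ^e * g°` to `ρ^f * (ρ(f, u, e) ≫ g)°`, for all idempotents `e`, `f`
and all `u ∈ fSe`. -/
theorem Gamma_map (e u f : S) (he : IsIdempotentElem e) (hf : IsIdempotentElem f)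
    (hu : ∃ s, u = f * s * e) {c : LCat S} (g : LCat.ofIdem e he ⟶ c)
    (x : (((Gamma S).obj (RCat.ofIdem e he)).obj.obj c).carrier)
    (hx : x.1 = (LCat.principalCone e).star g) :
    (((Gamma S).map (RCat.kappa e u f he hf hu)).hom.app c x).1 =
      (LCat.principalCone f).star (LCat.rho f u e hf he hu ≫ g) := by
  have hm := mul_assoc (G := S)
  let I := RCat.ofIdem e he
  let J := RCat.ofIdem f hf
  have hee := he.eq
  have hff := hf.eq
  have h1 : e * I.gen = I.gen := (RCat.mem_iff he rfl).1 I.gen_mem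
  have h3 : f * J.gen = J.gen := (RCat.mem_iff hf rfl).1 J.gen_mem
  have h4 : J.gen * f = f := (RCat.mem_iff J.isIdem_gen J.carrier_eq).1 ((RCat.mem_iff hf rfl).2 hf)
  have h2 : I.gen * e = e := (RCat.mem_iff I.isIdem_gen I.carrier_eq).1 ((RCat.mem_iff he rfl).2 he)
  obtain ⟨k, hk⟩ : ∃ k, (LCat.principalCone I.gen).star k = x.1 := x.2
  have hx' : x = ⟨(LCat.principalCone I.gen).star k, k, rfl⟩ := Subtype.ext hk.symm
  have h0 : (((Gamma S).map (RCat.kappa e u f he hf hu)).hom.app c x).1 =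
      (LCat.principalCone J.gen).star
        ((show (LCat.principalCone J.gen).apex ⟶ (LCat.principalCone I.gen).apex from
          LCat.rho J.gen (u * I.gen) I.gen J.isIdem_gen I.isIdem_gen (RCat.exists_toFun_eq
            (RCat.kappa e u f he hf hu) I.isIdem_gen J.isIdem_gen I.gen_mem J.carrier_eq)) ≫ k) := by
    rw [hx']
    exact congrArg Subtype.val (HMap_star _ _ _ k)
  refine h0.trans ?_
  rw [← hk] at hx
  refine NormalCone.star_eq_star _ _ fun d => LCat.hom_ext fun y => ?_
  have key := NormalCone.comp_eq_of_star_eq _ _ hx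
  obtain ⟨_, w, _, _, _, _, _, _, hw⟩ := k.isTranslation
  obtain ⟨_, v, _, _, _, _, _, _, hv⟩ := g.isTranslation
  have hE := congrArg (fun t => (t.toFun ⟨e, (LCat.mem_iff he rfl).2 he⟩).1) (key (LCat.ofIdem e he))
  have hE' : (k.toFun ⟨e * I.gen, e, rfl⟩).1 = (g.toFun ⟨e * e, e, rfl⟩).1 := hE
  rw [hw, hv] at hE'
  change (k.toFun ⟨(y.1 * J.gen) * (u * I.gen), _⟩).1 = (g.toFun ⟨(y.1 * f) * u, _⟩).1
  rw [hw, hv]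
  change ((y.1 * J.gen) * (u * I.gen)) * w = ((y.1 * f) * u) * v
  obtain ⟨s, hs⟩ := hu
  have h5 : u * e = u := by grind
  have h6 : f * u = u := by grind
  have h7 : J.gen * u = u := by grind
  change (e * I.gen) * w = (e * e) * v at hE'
  have h8 : u * (I.gen * w) = u * v := by
    have : u * ((e * I.gen) * w) = u * ((e * e) * v) := by rw [hE']
    grind
  grind

/-- The cross-connection functor `Δ : L(S) ⥤ N*R(S)` of the regular semigroup `S`:
`Δ(Se) = H(λ^e; -)`, and `Δ(ρ(e, u, f)) = η_{λ^e} ≫ R(S)(κ(f, u, e), -) ≫ η_{λ^f}⁻¹`, that is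
`λ^e * g° ↦ λ^f * (κ(f, u, e) ≫ g)°`.  The idempotent `e` with `I = Se` is chosen; `Delta_obj` and
`Delta_map` show that the functor does not depend on the choices. -/
noncomputable def Delta : LCat S ⥤ NormalDual (RCat S) where
  obj I := ⟨H (RCat.principalCone I.gen), _, RCat.isIdempotentElem_principalCone I.isIdem_gen, rfl⟩
  map {I J} φ := ObjectProperty.homMk (HMap _ _ (RCat.kappa J.gen (φ.toFun ⟨I.gen, I.gen_mem⟩).1 I.gen
    J.isIdem_gen I.isIdem_gen (LCat.exists_toFun_eq φ I.isIdem_gen J.isIdem_gen I.gen_mem J.carrier_eq)))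
  map_id I := by
    apply ObjectProperty.hom_ext
    refine HMap_eq_id _ _ (RCat.hom_ext fun x => ?_)
    exact (RCat.mem_iff I.isIdem_gen rfl).1 x.2
  map_comp {I J K} φ ψ := by
    have hm := mul_assoc (G := S)
    apply ObjectProperty.hom_ext
    refine HMap_eq_comp _ _ _ _ _ _ (RCat.hom_ext fun x => ?_)
    have h := LCat.toFun_eq ψ J.isIdem_gen J.carrier_eq J.gen_mem (φ.toFun ⟨I.gen, I.gen_mem⟩)
    change (ψ.toFun (φ.toFun ⟨I.gen, I.gen_mem⟩)).1 * x.1 =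
      (φ.toFun ⟨I.gen, I.gen_mem⟩).1 * ((ψ.toFun ⟨J.gen, J.gen_mem⟩).1 * x.1)
    rw [h]
    grind

/-- `Δ(Se) = H(λ^e; -)` for every idempotent `e`. -/
theorem Delta_obj (e : S) (he : IsIdempotentElem e) :
    ((Delta S).obj (LCat.ofIdem e he)).obj = H (RCat.principalCone e) := by
  have hm := mul_assoc (G := S)
  let I := LCat.ofIdem e he
  have h1 : I.gen * e = I.gen := (LCat.mem_iff he rfl).1 I.gen_mem
  have h2 : e * I.gen = e := (LCat.mem_iff I.isIdem_gen I.carrier_eq).1 ((LCat.mem_iff he rfl).2 he)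
  refine H_eq_H (RCat.homOf _ _ I.gen fun x _ => ⟨x, rfl⟩)
    (RCat.homOf _ _ e fun x _ => ⟨x, rfl⟩) (fun c => RCat.hom_ext fun x => ?_)
    (fun c => RCat.hom_ext fun x => ?_)
  · change I.gen * (e * x.1) = I.gen * x.1
    grind
  · change e * (I.gen * x.1) = e * x.1
    grind

/-- `Δ(ρ(e, u, f))` maps `λ^e * g°` to `λ^f * (κ(f, u, e) ≫ g)°`, for all idempotents `e`, `f`
and all `u ∈ eSf`. -/
theorem Delta_map (e u f : S) (he : IsIdempotentElem e) (hf : IsIdempotentElem f)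
    (hu : ∃ s, u = e * s * f) {c : RCat S} (g : RCat.ofIdem e he ⟶ c)
    (x : (((Delta S).obj (LCat.ofIdem e he)).obj.obj c).carrier)
    (hx : x.1 = (RCat.principalCone e).star g) :
    (((Delta S).map (LCat.rho e u f he hf hu)).hom.app c x).1 =
      (RCat.principalCone f).star (RCat.kappa f u e hf he hu ≫ g) := by
  have hm := mul_assoc (G := S)
  let I := LCat.ofIdem e he
  let J := LCat.ofIdem f hf
  have hee := he.eq
  have hff := hf.eq
  have h1 : I.gen * e = I.gen := (LCat.mem_iff he rfl).1 I.gen_mem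
  have h3 : J.gen * f = J.gen := (LCat.mem_iff hf rfl).1 J.gen_mem
  have h4 : f * J.gen = f := (LCat.mem_iff J.isIdem_gen J.carrier_eq).1 ((LCat.mem_iff hf rfl).2 hf)
  have h2 : e * I.gen = e := (LCat.mem_iff I.isIdem_gen I.carrier_eq).1 ((LCat.mem_iff he rfl).2 he)
  obtain ⟨k, hk⟩ : ∃ k, (RCat.principalCone I.gen).star k = x.1 := x.2
  have hx' : x = ⟨(RCat.principalCone I.gen).star k, k, rfl⟩ := Subtype.ext hk.symm
  have h0 : (((Delta S).map (LCat.rho e u f he hf hu)).hom.app c x).1 =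
      (RCat.principalCone J.gen).star
        ((show (RCat.principalCone J.gen).apex ⟶ (RCat.principalCone I.gen).apex from
          RCat.kappa J.gen (I.gen * u) I.gen J.isIdem_gen I.isIdem_gen (LCat.exists_toFun_eq
            (LCat.rho e u f he hf hu) I.isIdem_gen J.isIdem_gen I.gen_mem J.carrier_eq)) ≫ k) := by
    rw [hx']
    exact congrArg Subtype.val (HMap_star _ _ _ k)
  refine h0.trans ?_
  rw [← hk] at hx
  refine NormalCone.star_eq_star _ _ fun d => RCat.hom_ext fun y => ?_
  have key := NormalCone.comp_eq_of_star_eq _ _ hx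
  obtain ⟨_, w, _, _, _, _, _, _, hw⟩ := k.isTranslation
  obtain ⟨_, v, _, _, _, _, _, _, hv⟩ := g.isTranslation
  have hE := congrArg (fun t => (t.toFun ⟨e, (RCat.mem_iff he rfl).2 he⟩).1) (key (RCat.ofIdem e he))
  have hE' : (k.toFun ⟨I.gen * e, e, rfl⟩).1 = (g.toFun ⟨e * e, e, rfl⟩).1 := hE
  rw [hw, hv] at hE'
  change (k.toFun ⟨(I.gen * u) * (J.gen * y.1), _⟩).1 = (g.toFun ⟨u * (f * y.1), _⟩).1
  rw [hw, hv]
  change w * ((I.gen * u) * (J.gen * y.1)) = v * (u * (f * y.1))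
  obtain ⟨s, hs⟩ := hu
  have h5 : e * u = u := by grind
  have h6 : u * f = u := by grind
  have h7 : u * J.gen = u := by grind
  change w * (I.gen * e) = v * (e * e) at hE'
  have h8 : (w * I.gen) * u = v * u := by
    have : (w * (I.gen * e)) * u = (v * (e * e)) * u := by rw [hE']
    grind
  grind

end Connections

end CrossConnection

/-!
For a regular semigroup, `Γ` is fully faithful: by the Yoneda lemma every natural transformation
`H(γ; -) ⟶ H(δ; -)` is induced by a unique morphism `c_δ ⟶ c_γ` (`HMap_bijective`), and
`κ(e, u, f) ↦ ρ(f, u, e)` is a bijection from the morphisms `eS ⟶ fS` onto the morphisms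
`Sf ⟶ Se`.  It also preserves inclusions.

What is special about a semilattice `S` is that every morphism `x ↦ x * u` of `L(S)` is decreasing
for the natural order, hence an isomorphism fixes every element.  A normal cone `γ` whose apex is
generated by `e` is therefore the identity at `Se`; comparing its components at `c`, at `Se` and at
the ideals contained in both yields `γ(c) : x ↦ x * e` (`LCat.app_eq_mul_gen`).  So every normal
cone is principal, and `Γ` is surjective on objects.  Moreover `Γ` reflects inclusions, and so it is
also injective on objects, because mutual inclusion of objects is equality.  A functor with all
these properties is an isomorphism of categories with subobjects (`isNormalIso_of_fullyFaithful`),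
and normality of the target follows from that of the source (`normalCategory_of_fullyFaithful`).
The functor `Δ` is treated in the same way, with left and right exchanged.
-/

namespace CrossConnection

/-! ### Isomorphisms of categories with subobjects -/

section Transport

variable {C : Type*} [Category C] [SubobjectCategory C] {D : Type*} [Category D]
  [SubobjectCategory D]

theorem incl_eqToHom {a b : C} (h : a = b) : SubobjectCategory.Incl (eqToHom h) := by
  subst h
  exact SubobjectCategory.incl_id a

theorem IsNormalIso.symm {F : C ⥤ D} (hF : IsNormalIso F) : NormalIsomorphic D C := by
  obtain ⟨G, h1, h2, h3, h4⟩ := hF.exists_inverse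
  exact ⟨G, ⟨F, h2, h1, h4, h3⟩⟩

/-- Objects with equal images are included in each other, and so they are equal. -/
theorem obj_injective_of_full (F : C ⥤ D) [F.Full]
    (hincl : ∀ {a b : C} (f : a ⟶ b),
      SubobjectCategory.Incl (F.map f) ↔ SubobjectCategory.Incl f) :
    Function.Injective F.obj := by
  intro a b h
  refine SubobjectCategory.incl_antisymm (F.preimage (eqToHom h)) (F.preimage (eqToHom h.symm))
    ((hincl _).1 ?_) ((hincl _).1 ?_) <;>
  · rw [F.map_preimage]
    exact incl_eqToHom _

theorem isNormalIso_of_fullyFaithful (F : C ⥤ D) [F.Full] [F.Faithful]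
    (hsurj : Function.Surjective F.obj)
    (hincl : ∀ {a b : C} (f : a ⟶ b),
      SubobjectCategory.Incl (F.map f) ↔ SubobjectCategory.Incl f) :
    IsNormalIso F := by
  choose g hg using hsurj
  let G : D ⥤ C :=
    { obj := g
      map := fun {a b} f => F.preimage (eqToHom (hg a) ≫ f ≫ eqToHom (hg b).symm)
      map_id := fun a => F.map_injective (by simp)
      map_comp := fun f k => F.map_injective (by simp) }
  refine ⟨G, ?_, ?_, fun f hf => (hincl f).2 hf, fun {a b} f hf => (hincl _).1 ?_⟩
  · refine CategoryTheory.Functor.ext (fun a => obj_injective_of_full F hincl (hg _))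
      fun a b f => F.map_injective ?_
    simp [G, eqToHom_map]
  · refine CategoryTheory.Functor.ext hg fun a b f => ?_
    simp [G]
  · simp only [G, F.map_preimage]
    exact SubobjectCategory.incl_comp _ _ (incl_eqToHom _)
      (SubobjectCategory.incl_comp _ _ hf (incl_eqToHom _))

theorem IsRetraction.map (F : C ⥤ D) {a b : C} {q : a ⟶ b} (hq : IsRetraction q)
    (hF : ∀ {a b : C} (f : a ⟶ b), SubobjectCategory.Incl f → SubobjectCategory.Incl (F.map f)) :
    IsRetraction (F.map q) := by
  obtain ⟨j, hj, h⟩ := hq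
  exact ⟨F.map j, hF j hj, by rw [← F.map_comp, h, F.map_id]⟩

/-- The image of a normal cone under an isomorphism of categories with subobjects, given by its
apex and its components at the objects `F.obj b`. -/
theorem exists_cone_map (F : C ⥤ D) [F.Full] (hsurj : Function.Surjective F.obj)
    (hincl : ∀ {a b : C} (f : a ⟶ b),
      SubobjectCategory.Incl (F.map f) ↔ SubobjectCategory.Incl f)
    (γ : NormalCone C) :
    ∃ (δ : NormalCone D) (h : δ.apex = F.obj γ.apex),
      ∀ b, δ.app (F.obj b) ≫ eqToHom h = F.map (γ.app b) := by
  choose g hg using hsurj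
  refine ⟨⟨F.obj γ.apex, fun c => eqToHom (hg c).symm ≫ F.map (γ.app (g c)), ?_, ?_⟩, rfl, ?_⟩
  · intro a b j hj
    let i : g a ⟶ g b := F.preimage (eqToHom (hg a) ≫ j ≫ eqToHom (hg b).symm)
    have hi : F.map i = eqToHom (hg a) ≫ j ≫ eqToHom (hg b).symm := F.map_preimage _
    have hi' : SubobjectCategory.Incl i := by
      rw [← hincl, hi]
      exact SubobjectCategory.incl_comp _ _ (incl_eqToHom _)
        (SubobjectCategory.incl_comp _ _ hj (incl_eqToHom _))
    rw [← γ.incl_app i hi', F.map_comp, hi]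
    simp
  · obtain ⟨m, hm⟩ := γ.exists_isIso
    have e : g (F.obj m) = m := obj_injective_of_full F hincl (hg _)
    refine ⟨F.obj m, ?_⟩
    have : IsIso (γ.app (g (F.obj m))) := by rwa [e]
    infer_instance
  · intro b
    have e : g (F.obj b) = b := obj_injective_of_full F hincl (hg _)
    have key : ∀ (c : C) (h : c = b) (h' : F.obj b = F.obj c),
        eqToHom h' ≫ F.map (γ.app c) = F.map (γ.app b) := by
      rintro c rfl _
      simp
    simpa using key _ e _

theorem normalCategory_of_fullyFaithful [NormalCategory C] (F : C ⥤ D) [F.Full]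
    (hsurj : Function.Surjective F.obj)
    (hincl : ∀ {a b : C} (f : a ⟶ b),
      SubobjectCategory.Incl (F.map f) ↔ SubobjectCategory.Incl f) :
    NormalCategory D where
  incl_splits {a b} j hj := by
    obtain ⟨a, rfl⟩ := hsurj a
    obtain ⟨b, rfl⟩ := hsurj b
    obtain ⟨j, rfl⟩ := F.map_surjective j
    obtain ⟨q, hq⟩ := NormalCategory.incl_splits j ((hincl j).1 hj)
    exact ⟨F.map q, by rw [← F.map_comp, hq, F.map_id]⟩
  exists_factorization {a b} f := by
    obtain ⟨a, rfl⟩ := hsurj a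
    obtain ⟨b, rfl⟩ := hsurj b
    obtain ⟨f, rfl⟩ := F.map_surjective f
    obtain ⟨c, i, q, u, j, hq, hu, hj, h⟩ := NormalCategory.exists_factorization f
    exact ⟨⟨F.obj c, F.obj i, F.map q, F.map u, F.map j, hq.map F fun f => (hincl f).2,
      inferInstance, (hincl j).2 hj, by rw [← h, F.map_comp, F.map_comp]⟩⟩
  exists_cone c := by
    obtain ⟨c, rfl⟩ := hsurj c
    obtain ⟨γ, rfl, hγ⟩ := NormalCategory.exists_cone c
    obtain ⟨δ, h, hδ⟩ := exists_cone_map F hsurj hincl γ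
    refine ⟨δ, h, ?_⟩
    rw [eqToHom_refl, Category.comp_id] at hγ
    rw [hδ, hγ, F.map_id]

end Transport

/-! ### Morphisms between `H`-functors -/

section HFunctor

variable {C : Type u} [Category.{v} C] [SubobjectCategory C] [NormalCategory C]

theorem eta_HMap (γ δ : NormalCone C) (k : δ.apex ⟶ γ.apex) {c : C} (x : ((H γ).obj c).carrier) :
    eta δ c ((HMap γ δ k).app c x) = k ≫ eta γ c x :=
  (eta δ c).apply_symm_apply _

/-- The Yoneda lemma for `H`-functors: they are represented by the apexes of the cones. -/
theorem HMap_bijective (γ δ : NormalCone C) : Function.Bijective (HMap γ δ) := by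
  constructor
  · intro k l h
    have e := congrArg (fun t => eta δ _ (t.app γ.apex ((eta γ _).symm (𝟙 _)))) h
    simpa only [eta_HMap, Equiv.apply_symm_apply, Category.comp_id] using e
  · intro t
    refine ⟨eta δ _ (t.app γ.apex ((eta γ _).symm (𝟙 _))), ?_⟩
    ext c
    funext x
    apply (eta δ c).injective
    rw [eta_HMap, ← eta_map]
    congr 1
    refine (congrFun (t.naturality (eta γ c x)) ((eta γ _).symm (𝟙 _))).symm.trans ?_
    refine congrArg (t.app c) ((eta γ c).injective ?_)
    refine (eta_map γ _ _).trans ?_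
    rw [Equiv.apply_symm_apply, Category.id_comp]

/-- The transformation induced by `k` is an inclusion of functors exactly if `k` carries the cone
`δ` to the cone `γ`. -/
theorem HMap_val_eq_iff (γ δ : NormalCone C) (k : δ.apex ⟶ γ.apex) :
    (∀ (c : C) (x : ((H γ).obj c).carrier), ((HMap γ δ k).app c x).1 = x.1) ↔
      ∀ c, δ.app c ≫ k = γ.app c := by
  constructor
  · intro h c
    have e := h γ.apex ⟨γ.star (𝟙 _), 𝟙 _, rfl⟩
    rw [HMap_star] at e
    simpa only [Category.comp_id] using NormalCone.comp_eq_of_star_eq _ _ e c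
  · rintro h c ⟨_, f, rfl⟩
    rw [HMap_star]
    exact NormalCone.star_eq_star _ _ fun d => by rw [← Category.assoc, h]

end HFunctor

/-! ### The functor `Γ` -/

section Gamma

variable (S : Type u) [Semigroup S]

theorem Gamma_map_bijective [RegularSemigroup S] (I J : RCat S) :
    Function.Bijective fun φ : I ⟶ J => (Gamma S).map φ := by
  have hm := mul_assoc (G := S)
  constructor
  · intro φ ψ h
    have e := (HMap_bijective _ _).1 (congrArg (fun t => t.hom) h)
    have e' := congrArg (fun t : LCat.ofIdem J.gen J.isIdem_gen ⟶ LCat.ofIdem I.gen I.isIdem_gen =>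
      (t.toFun ⟨J.gen, J.gen, J.isIdem_gen⟩).1) e
    change J.gen * (φ.toFun ⟨I.gen, I.gen_mem⟩).1 = J.gen * (ψ.toFun ⟨I.gen, I.gen_mem⟩).1 at e'
    rw [(RCat.mem_iff J.isIdem_gen J.carrier_eq).1 (Subtype.property _),
      (RCat.mem_iff J.isIdem_gen J.carrier_eq).1 (Subtype.property _)] at e'
    refine RCat.hom_ext fun x => ?_
    rw [RCat.toFun_eq φ I.isIdem_gen I.carrier_eq I.gen_mem,
      RCat.toFun_eq ψ I.isIdem_gen I.carrier_eq I.gen_mem, e']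
  · intro t
    obtain ⟨k, hk⟩ := (HMap_bijective (LCat.principalCone I.gen) (LCat.principalCone J.gen)).2 t.hom
    change LCat.ofIdem J.gen J.isIdem_gen ⟶ LCat.ofIdem I.gen I.isIdem_gen at k
    have hJ : J.gen ∈ (LCat.ofIdem J.gen J.isIdem_gen).carrier := ⟨J.gen, J.isIdem_gen⟩
    obtain ⟨s, hs⟩ := LCat.exists_toFun_eq k J.isIdem_gen I.isIdem_gen hJ rfl
    have hI := I.isIdem_gen.eq
    refine ⟨RCat.homOf I J (k.toFun ⟨J.gen, hJ⟩).1 fun x _ => ?_, ?_⟩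
    · rw [hs, J.carrier_eq]
      exact ⟨s * I.gen * x, by grind⟩
    · apply ObjectProperty.hom_ext
      rw [← hk]
      refine congrArg (HMap _ _) (LCat.hom_ext fun x => ?_)
      refine Eq.trans ?_ (LCat.toFun_eq k J.isIdem_gen rfl hJ x).symm
      change x.1 * ((k.toFun ⟨J.gen, hJ⟩).1 * I.gen) = x.1 * (k.toFun ⟨J.gen, hJ⟩).1
      grind

instance [RegularSemigroup S] : (Gamma S).Full := ⟨(Gamma_map_bijective S _ _).2⟩

instance [RegularSemigroup S] : (Gamma S).Faithful := ⟨fun h => (Gamma_map_bijective S _ _).1 h⟩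

variable [IsSemilattice S]

theorem Gamma_map_incl_iff {I J : RCat S} (φ : I ⟶ J) :
    SubobjectCategory.Incl ((Gamma S).map φ) ↔ SubobjectCategory.Incl φ := by
  have hm := mul_assoc (G := S)
  have hc := IsSemilattice.mul_comm (S := S)
  have hu := (RCat.mem_iff J.isIdem_gen J.carrier_eq).1 (φ.toFun ⟨I.gen, I.gen_mem⟩).2
  have hφ := RCat.toFun_eq φ I.isIdem_gen I.carrier_eq I.gen_mem
  refine (HMap_val_eq_iff _ _ _).trans ⟨fun h x => ?_, fun h c => LCat.hom_ext fun x => ?_⟩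
  · -- Evaluating the equality of cones at the generator of `I` shows that `φ` fixes it.
    have e : I.gen * J.gen * (φ.toFun ⟨I.gen, I.gen_mem⟩).1 = I.gen * I.gen :=
      congrArg (fun t => (t.toFun ⟨I.gen, I.gen, I.isIdem_gen⟩).1)
        (h (LCat.ofIdem I.gen I.isIdem_gen))
    have e1 : (φ.toFun ⟨I.gen, I.gen_mem⟩).1 = I.gen := by
      have e2 := hφ ⟨I.gen, I.gen_mem⟩
      rw [hm, hu, hc] at e
      exact e2.trans (e.trans I.isIdem_gen)
    rw [hφ, e1]
    exact (RCat.mem_iff I.isIdem_gen I.carrier_eq).1 x.2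
  · have e := h ⟨I.gen, I.gen_mem⟩
    change x.1 * J.gen * (φ.toFun ⟨I.gen, I.gen_mem⟩).1 = x.1 * I.gen
    rw [hm, hu, e]

variable {S}

/-- Morphisms are decreasing for the natural order, and so isomorphisms fix every element. -/
theorem LCat.toFun_eq_self_of_isIso {I J : LCat S} (φ : I ⟶ J) [IsIso φ] (x : I.carrier) :
    (φ.toFun x).1 = x.1 := by
  have hm := mul_assoc (G := S)
  have hc := IsSemilattice.mul_comm (S := S)
  have hs := IsSemilattice.mul_self (S := S)
  obtain ⟨_, u, _, _, _, _, _, _, hu⟩ := φ.isTranslation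
  obtain ⟨_, v, _, _, _, _, _, _, hv⟩ := (inv φ).isTranslation
  have e : ((φ ≫ inv φ).toFun x).1 = x.1 := by
    rw [IsIso.hom_inv_id]
    rfl
  rw [LCat.comp_toFun, hv, hu] at e
  rw [hu, ← e]
  grind

/-- Every normal cone in `L(S)` is principal. -/
theorem LCat.app_eq_mul_gen (γ : NormalCone (LCat S)) (I : LCat S) (x : I.carrier) :
    ((γ.app I).toFun x).1 = x.1 * γ.apex.gen := by
  have hm := mul_assoc (G := S)
  have hc := IsSemilattice.mul_comm (S := S)
  have hs := IsSemilattice.mul_self (S := S)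
  obtain ⟨m, hγ⟩ := γ.exists_isIso
  set e := γ.apex.gen
  have he : e ∈ m.carrier := by
    have h := LCat.toFun_eq_self_of_isIso (inv (γ.app m)) ⟨e, γ.apex.gen_mem⟩
    change _ = e at h
    rw [← h]
    exact Subtype.property _
  -- The ideal generated by `x * e` lies in `I` and in `m`, where the cone is the identity.
  let K : LCat S := LCat.ofIdem (x.1 * e) (hs _)
  let i : K ⟶ I := LCat.homOf K I (x.1 * e) fun y _ => by
    have hx := (LCat.mem_iff I.isIdem_gen I.carrier_eq).1 x.2
    rw [LCat.mem_iff I.isIdem_gen I.carrier_eq]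
    grind
  let j : K ⟶ m := LCat.homOf K m (x.1 * e) fun y _ => by
    have hx := (LCat.mem_iff m.isIdem_gen m.carrier_eq).1 he
    rw [LCat.mem_iff m.isIdem_gen m.carrier_eq]
    grind
  have hK : ∀ y : K.carrier, y.1 * (x.1 * e) = y.1 := fun y => (LCat.mem_iff (hs _) rfl).1 y.2
  have hij := congrArg (fun t => (t.toFun ⟨x.1 * e, x.1, by grind⟩).1)
    ((γ.incl_app i hK).trans (γ.incl_app j hK).symm)
  change ((γ.app I).toFun _).1 = ((γ.app m).toFun _).1 at hij
  rw [LCat.toFun_eq_self_of_isIso (γ.app m)] at hij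
  change _ = x.1 * e * (x.1 * e) at hij
  obtain ⟨_, u, _, _, _, _, _, _, hu⟩ := (γ.app I).isTranslation
  have hx := (LCat.mem_iff γ.apex.isIdem_gen γ.apex.carrier_eq).1 ((γ.app I).toFun x).2
  rw [hu] at hij hx ⊢
  change x.1 * e * (x.1 * e) * u = _ at hij
  change x.1 * u * e = _ at hx
  grind

variable (S)

theorem Gamma_obj_surjective : Function.Surjective (Gamma S).obj := by
  have hm := mul_assoc (G := S)
  rintro ⟨_, γ, hγ, rfl⟩
  have he := γ.apex.isIdem_gen
  have hmem : ∀ x, x * γ.apex.gen ∈ γ.apex.carrier := fun x => by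
    rw [γ.apex.carrier_eq]
    exact ⟨x, rfl⟩
  refine ⟨RCat.ofIdem _ he, ObjectProperty.FullSubcategory.ext ?_⟩
  refine (Gamma_obj S _ he).trans (H_eq_H (LCat.homOf _ _ γ.apex.gen fun x _ => ⟨x, rfl⟩)
    (LCat.homOf _ _ γ.apex.gen fun x _ => hmem x) (fun c => LCat.hom_ext fun x => ?_)
    fun c => LCat.hom_ext fun x => ?_)
  · change ((γ.app c).toFun x).1 * γ.apex.gen = x.1 * γ.apex.gen
    rw [LCat.app_eq_mul_gen, hm, he.eq]
  · change x.1 * γ.apex.gen * γ.apex.gen = ((γ.app c).toFun x).1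
    rw [LCat.app_eq_mul_gen, hm, he.eq]

end Gamma

/-! ### The functor `Δ` -/

section Delta

variable (S : Type u) [Semigroup S]

theorem Delta_map_bijective [RegularSemigroup S] (I J : LCat S) :
    Function.Bijective fun φ : I ⟶ J => (Delta S).map φ := by
  have hm := mul_assoc (G := S)
  constructor
  · intro φ ψ h
    have e := (HMap_bijective _ _).1 (congrArg (fun t => t.hom) h)
    have e' := congrArg (fun t : RCat.ofIdem J.gen J.isIdem_gen ⟶ RCat.ofIdem I.gen I.isIdem_gen =>
      (t.toFun ⟨J.gen, J.gen, J.isIdem_gen⟩).1) e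
    change (φ.toFun ⟨I.gen, I.gen_mem⟩).1 * J.gen = (ψ.toFun ⟨I.gen, I.gen_mem⟩).1 * J.gen at e'
    rw [(LCat.mem_iff J.isIdem_gen J.carrier_eq).1 (Subtype.property _),
      (LCat.mem_iff J.isIdem_gen J.carrier_eq).1 (Subtype.property _)] at e'
    refine LCat.hom_ext fun x => ?_
    rw [LCat.toFun_eq φ I.isIdem_gen I.carrier_eq I.gen_mem,
      LCat.toFun_eq ψ I.isIdem_gen I.carrier_eq I.gen_mem, e']
  · intro t
    obtain ⟨k, hk⟩ := (HMap_bijective (RCat.principalCone I.gen) (RCat.principalCone J.gen)).2 t.hom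
    change RCat.ofIdem J.gen J.isIdem_gen ⟶ RCat.ofIdem I.gen I.isIdem_gen at k
    have hJ : J.gen ∈ (RCat.ofIdem J.gen J.isIdem_gen).carrier := ⟨J.gen, J.isIdem_gen⟩
    obtain ⟨s, hs⟩ := RCat.exists_toFun_eq k J.isIdem_gen I.isIdem_gen hJ rfl
    have hI := I.isIdem_gen.eq
    refine ⟨LCat.homOf I J (k.toFun ⟨J.gen, hJ⟩).1 fun x _ => ?_, ?_⟩
    · rw [hs, J.carrier_eq]
      exact ⟨x * I.gen * s, by grind⟩
    · apply ObjectProperty.hom_ext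
      rw [← hk]
      refine congrArg (HMap _ _) (RCat.hom_ext fun x => ?_)
      refine Eq.trans ?_ (RCat.toFun_eq k J.isIdem_gen rfl hJ x).symm
      change (I.gen * (k.toFun ⟨J.gen, hJ⟩).1) * x.1 = (k.toFun ⟨J.gen, hJ⟩).1 * x.1
      grind

instance [RegularSemigroup S] : (Delta S).Full := ⟨(Delta_map_bijective S _ _).2⟩

instance [RegularSemigroup S] : (Delta S).Faithful := ⟨fun h => (Delta_map_bijective S _ _).1 h⟩

variable [IsSemilattice S]

theorem Delta_map_incl_iff {I J : LCat S} (φ : I ⟶ J) :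
    SubobjectCategory.Incl ((Delta S).map φ) ↔ SubobjectCategory.Incl φ := by
  have hm := mul_assoc (G := S)
  have hc := IsSemilattice.mul_comm (S := S)
  have hu := (LCat.mem_iff J.isIdem_gen J.carrier_eq).1 (φ.toFun ⟨I.gen, I.gen_mem⟩).2
  have hφ := LCat.toFun_eq φ I.isIdem_gen I.carrier_eq I.gen_mem
  refine (HMap_val_eq_iff _ _ _).trans ⟨fun h x => ?_, fun h c => RCat.hom_ext fun x => ?_⟩
  · -- Evaluating the equality of cones at the generator of `I` shows that `φ` fixes it.
    have e : (φ.toFun ⟨I.gen, I.gen_mem⟩).1 * (J.gen * I.gen) = I.gen * I.gen :=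
      congrArg (fun t => (t.toFun ⟨I.gen, I.gen, I.isIdem_gen⟩).1)
        (h (RCat.ofIdem I.gen I.isIdem_gen))
    have e1 : (φ.toFun ⟨I.gen, I.gen_mem⟩).1 = I.gen := by
      have e2 := hφ ⟨I.gen, I.gen_mem⟩
      rw [← hm, hu, hc] at e
      exact e2.trans (e.trans I.isIdem_gen)
    rw [hφ, e1]
    exact (LCat.mem_iff I.isIdem_gen I.carrier_eq).1 x.2
  · have e := h ⟨I.gen, I.gen_mem⟩
    change (φ.toFun ⟨I.gen, I.gen_mem⟩).1 * (J.gen * x.1) = I.gen * x.1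
    rw [← hm, hu, e]

variable {S}

/-- Morphisms are decreasing for the natural order, and so isomorphisms fix every element. -/
theorem RCat.toFun_eq_self_of_isIso {I J : RCat S} (φ : I ⟶ J) [IsIso φ] (x : I.carrier) :
    (φ.toFun x).1 = x.1 := by
  have hm := mul_assoc (G := S)
  have hc := IsSemilattice.mul_comm (S := S)
  have hs := IsSemilattice.mul_self (S := S)
  obtain ⟨_, u, _, _, _, _, _, _, hu⟩ := φ.isTranslation
  obtain ⟨_, v, _, _, _, _, _, _, hv⟩ := (inv φ).isTranslation
  have e : ((φ ≫ inv φ).toFun x).1 = x.1 := by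
    rw [IsIso.hom_inv_id]
    rfl
  rw [RCat.comp_toFun, hv, hu] at e
  rw [hu, ← e]
  grind

/-- Every normal cone in `R(S)` is principal. -/
theorem RCat.app_eq_gen_mul (γ : NormalCone (RCat S)) (I : RCat S) (x : I.carrier) :
    ((γ.app I).toFun x).1 = γ.apex.gen * x.1 := by
  have hm := mul_assoc (G := S)
  have hc := IsSemilattice.mul_comm (S := S)
  have hs := IsSemilattice.mul_self (S := S)
  obtain ⟨m, hγ⟩ := γ.exists_isIso
  set e := γ.apex.gen
  have he : e ∈ m.carrier := by
    have h := RCat.toFun_eq_self_of_isIso (inv (γ.app m)) ⟨e, γ.apex.gen_mem⟩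
    change _ = e at h
    rw [← h]
    exact Subtype.property _
  -- The ideal generated by `e * x` lies in `I` and in `m`, where the cone is the identity.
  let K : RCat S := RCat.ofIdem (e * x.1) (hs _)
  let i : K ⟶ I := RCat.homOf K I (e * x.1) fun y _ => by
    have hx := (RCat.mem_iff I.isIdem_gen I.carrier_eq).1 x.2
    rw [RCat.mem_iff I.isIdem_gen I.carrier_eq]
    grind
  let j : K ⟶ m := RCat.homOf K m (e * x.1) fun y _ => by
    have hx := (RCat.mem_iff m.isIdem_gen m.carrier_eq).1 he
    rw [RCat.mem_iff m.isIdem_gen m.carrier_eq]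
    grind
  have hK : ∀ y : K.carrier, e * x.1 * y.1 = y.1 := fun y => (RCat.mem_iff (hs _) rfl).1 y.2
  have hij := congrArg (fun t => (t.toFun ⟨e * x.1, x.1, by grind⟩).1)
    ((γ.incl_app i hK).trans (γ.incl_app j hK).symm)
  change ((γ.app I).toFun _).1 = ((γ.app m).toFun _).1 at hij
  rw [RCat.toFun_eq_self_of_isIso (γ.app m)] at hij
  change _ = e * x.1 * (e * x.1) at hij
  obtain ⟨_, u, _, _, _, _, _, _, hu⟩ := (γ.app I).isTranslation
  have hx := (RCat.mem_iff γ.apex.isIdem_gen γ.apex.carrier_eq).1 ((γ.app I).toFun x).2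
  rw [hu] at hij hx ⊢
  change u * (e * x.1 * (e * x.1)) = _ at hij
  change e * (u * x.1) = _ at hx
  grind

variable (S)

theorem Delta_obj_surjective : Function.Surjective (Delta S).obj := by
  have hm := mul_assoc (G := S)
  rintro ⟨_, γ, hγ, rfl⟩
  have he := γ.apex.isIdem_gen
  have hmem : ∀ x, γ.apex.gen * x ∈ γ.apex.carrier := fun x => by
    rw [γ.apex.carrier_eq]
    exact ⟨x, rfl⟩
  refine ⟨LCat.ofIdem _ he, ObjectProperty.FullSubcategory.ext ?_⟩
  refine (Delta_obj S _ he).trans (H_eq_H (RCat.homOf _ _ γ.apex.gen fun x _ => ⟨x, rfl⟩)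
    (RCat.homOf _ _ γ.apex.gen fun x _ => hmem x) (fun c => RCat.hom_ext fun x => ?_)
    fun c => RCat.hom_ext fun x => ?_)
  · change γ.apex.gen * ((γ.app c).toFun x).1 = γ.apex.gen * x.1
    rw [RCat.app_eq_gen_mul, ← hm, he.eq]
  · change γ.apex.gen * (γ.apex.gen * x.1) = ((γ.app c).toFun x).1
    rw [RCat.app_eq_gen_mul, ← hm, he.eq]

end Delta

end CrossConnection

theorem mainTheorem7 (S : Type u) [Semigroup S] [CrossConnection.IsSemilattice S] :
    (CrossConnection.NormalCategory (CrossConnection.NormalDual (CrossConnection.LCat S)) ∧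
      CrossConnection.NormalIsomorphic (CrossConnection.NormalDual (CrossConnection.LCat S))
        (CrossConnection.RCat S)) ∧
    (CrossConnection.NormalCategory (CrossConnection.NormalDual (CrossConnection.RCat S)) ∧
      CrossConnection.NormalIsomorphic (CrossConnection.NormalDual (CrossConnection.RCat S))
        (CrossConnection.LCat S)) ∧
    CrossConnection.IsNormalIso (CrossConnection.Gamma S) ∧
    CrossConnection.IsNormalIso (CrossConnection.Delta S) := by
  have hΓ := CrossConnection.isNormalIso_of_fullyFaithful (CrossConnection.Gamma S)
    (CrossConnection.Gamma_obj_surjective S) (CrossConnection.Gamma_map_incl_iff S)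
  have hΔ := CrossConnection.isNormalIso_of_fullyFaithful (CrossConnection.Delta S)
    (CrossConnection.Delta_obj_surjective S) (CrossConnection.Delta_map_incl_iff S)
  exact ⟨⟨CrossConnection.normalCategory_of_fullyFaithful (CrossConnection.Gamma S)
      (CrossConnection.Gamma_obj_surjective S) (CrossConnection.Gamma_map_incl_iff S), hΓ.symm⟩,
    ⟨CrossConnection.normalCategory_of_fullyFaithful (CrossConnection.Delta S)
      (CrossConnection.Delta_obj_surjective S) (CrossConnection.Delta_map_incl_iff S), hΔ.symm⟩,
    hΓ, hΔ⟩
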